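/- Let $K$ be a field, $m,n\ge 0$ integers, $X=(X_{ij})$ an $m\times n$ matrix of indeterminates and $K[X]$ the polynomial ring in its entries. For $a_1<\dots<a_t$ in $\{1,\dots,m\}$ and $b_1<\dots<b_t$ in $\{1,\dots,n\}$ let $[a_1\dots a_t\,|\,b_1\dots b_t]$ denote the minor $\det(X_{a_ib_j})_{1\le i,j\le t}$; the empty minor $[\,|\,]$ (the case $t=0$) has the value $1$. Minors are partially ordered by $$[a_1\dots a_t\,|\,b_1\dots b_t]\preceq[c_1\dots c_u\,|\,d_1\dots d_u]\iff t\ge u\text{ and } a_i\le c_i,\ b_i\le d_i\text{ for } i=1,\dots,u.$$ A bitableau is a (formal, commutative, possibly empty) product of non-empty minors, identified with its value in $K[X]$ where no confusion is possible. It is called standard if its factors can be ordered such that $\delta_1\preceq\dots\preceq\delta_w$. **Theorem (straightening law of Doubilet, Rota and Stein).** (a) The standard bitableaux are a $K$-vector space basis of $K[X]$. (b) If a product $\gamma\delta$ of two non-empty minors is not a standard bitableau (that is, if $\gamma$ and $\delta$ are incomparable), then it has a representation $$\gamma\delta=\sum_i x_i\,\epsilon_i\eta_i,\qquad x_i\in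 K,\ x_i\ne 0,$$ where the sum is finite, each $\epsilon_i\eta_i$ is a standard bitableau, $\epsilon_i$ is non-empty and $\epsilon_i\prec\gamma,\delta\prec\eta_i$; here $\eta_i=[\,|\,]=1$ is allowed. (c) The standard representation of an arbitrary bitableau $\Delta$, i.e. its representation as a $K$-linear combination of standard bitableaux, can be found by successive application of the straightening relations in (b). More precisely, let a straightening step, applied to a formal $K$-linear combination of bitableaux, consist in choosing a bitableau $\gamma\delta\Delta'$ that occurs in it with a coefficient $c\ne0$ and has two factors $\gamma,\delta$ whose product is not standard, and in replacing the term $c\,\gamma\delta\Delta'$ by $\sum_i c\,x_i\,\epsilon_i\eta_i\Delta'$, where $\gamma\delta=\sum_i x_i\epsilon_i\eta_i$ is a relation as in (b) (empty factors are dropped). Then finitely many straightening steps lead from $\Delta$ to its standard representation; moreover, every sequence of straightening steps that starts from $\Delta$ is finite, and whenever no further step is possible, the standard representation of $\Delta$ has been reached. -/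

import Mathlib

noncomputable section

namespace StraighteningLaw

open MvPolynomial

/-- A (possibly empty) minor `[a₁ … a_t | b₁ … b_t]` of the generic `m × n` matrix, as a
combinatorial object: it is given by the set `{a₁ < … < a_t}` of its row indices and the set
`{b₁ < … < b_t}` of its column indices. -/
@[ext]
structure Minor (m n : ℕ) where
  rows : Finset (Fin m)
  cols : Finset (Fin n)
  card_eq : cols.card = rows.card

namespace Minor

variable {m n : ℕ}

/-- The size `t` of the minor `[a₁ … a_t | b₁ … b_t]`. -/
def size (δ : Minor m n) : ℕ := δ.rows.card

/-- The row indices `a₁ < … < a_t`. -/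
def row (δ : Minor m n) : Fin δ.size ↪o Fin m := δ.rows.orderEmbOfFin rfl

/-- The column indices `b₁ < … < b_t`. -/
def col (δ : Minor m n) : Fin δ.size ↪o Fin n := δ.cols.orderEmbOfFin δ.card_eq

/-- The value of the minor in `K[X]`, the determinant of the matrix `(X_{a_i b_j})`.
The empty minor has the value `1`. -/
def eval (K : Type*) [Field K] (δ : Minor m n) : MvPolynomial (Fin m × Fin n) K :=
  Matrix.det (Matrix.of fun i j : Fin δ.size => X (δ.row i, δ.col j))

/-- `[a₁ … a_t | b₁ … b_t] ≤ [c₁ … c_u | d₁ … d_u]` if and only if `t ≥ u` and `a_i ≤ c_i`,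
`b_i ≤ d_i` for `i = 1, …, u`. The empty minor is the greatest element. -/
instance : LE (Minor m n) where
  le γ δ := ∃ h : δ.size ≤ γ.size, ∀ i : Fin δ.size,
    γ.row (Fin.castLE h i) ≤ δ.row i ∧ γ.col (Fin.castLE h i) ≤ δ.col i

theorem le_def (γ δ : Minor m n) : γ ≤ δ ↔ ∃ h : δ.size ≤ γ.size, ∀ i : Fin δ.size,
    γ.row (Fin.castLE h i) ≤ δ.row i ∧ γ.col (Fin.castLE h i) ≤ δ.col i := Iff.rfl

theorem mem_rows (δ : Minor m n) (x : Fin m) : x ∈ δ.rows ↔ ∃ i, δ.row i = x := by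
  rw [← Finset.mem_coe, ← Finset.range_orderEmbOfFin δ.rows rfl]
  rfl

theorem mem_cols (δ : Minor m n) (x : Fin n) : x ∈ δ.cols ↔ ∃ i, δ.col i = x := by
  rw [← Finset.mem_coe, ← Finset.range_orderEmbOfFin δ.cols δ.card_eq]
  rfl

instance : PartialOrder (Minor m n) where
  le_refl γ := ⟨le_rfl, fun _ => ⟨le_rfl, le_rfl⟩⟩
  le_trans := by
    rintro α β γ ⟨h1, h2⟩ ⟨h3, h4⟩
    exact ⟨h3.trans h1, fun i => ⟨(h2 (Fin.castLE h3 i)).1.trans (h4 i).1,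
      (h2 (Fin.castLE h3 i)).2.trans (h4 i).2⟩⟩
  le_antisymm := by
    rintro α β ⟨h1, h2⟩ ⟨h3, h4⟩
    have hr : ∀ i : Fin β.size, α.row (Fin.castLE h1 i) = β.row i :=
      fun i => le_antisymm (h2 i).1 (h4 (Fin.castLE h1 i)).1
    have hc : ∀ i : Fin β.size, α.col (Fin.castLE h1 i) = β.col i :=
      fun i => le_antisymm (h2 i).2 (h4 (Fin.castLE h1 i)).2
    ext x
    · rw [mem_rows, mem_rows]
      exact ⟨fun ⟨i, hi⟩ => ⟨Fin.castLE h3 i, by rw [← hr]; exact hi⟩,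
        fun ⟨i, hi⟩ => ⟨Fin.castLE h1 i, by rw [hr, hi]⟩⟩
    · rw [mem_cols, mem_cols]
      exact ⟨fun ⟨i, hi⟩ => ⟨Fin.castLE h3 i, by rw [← hc]; exact hi⟩,
        fun ⟨i, hi⟩ => ⟨Fin.castLE h1 i, by rw [hc, hi]⟩⟩

end Minor

/-- The partially ordered set of all non-empty minors of the generic `m × n` matrix. -/
abbrev NonemptyMinor (m n : ℕ) : Type := {δ : Minor m n // 0 < δ.size}

/-- A bitableau: a formal (commutative) product `δ₁ ⋯ δ_w`, `w ≥ 0`, of non-empty minors. -/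
abbrev Bitableau (m n : ℕ) : Type := Multiset (NonemptyMinor m n)

namespace Bitableau

variable {m n : ℕ}

/-- The value of a bitableau in `K[X]`: the product of the values of its factors. -/
def eval (K : Type*) [Field K] (Δ : Bitableau m n) : MvPolynomial (Fin m × Fin n) K :=
  (Δ.map fun δ => δ.1.eval K).prod

/-- A bitableau is standard if its factors can be written as a chain `δ₁ ≤ ⋯ ≤ δ_w`. -/
def IsStandard (Δ : Bitableau m n) : Prop :=
  ∃ l : List (NonemptyMinor m n), (l : Multiset (NonemptyMinor m n)) = Δ ∧ l.IsChain (· ≤ ·)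

/-- A single minor as a bitableau; an empty factor `[ | ]` is dropped. -/
def ofMinor (η : Minor m n) : Bitableau m n :=
  if h : 0 < η.size then {⟨η, h⟩} else 0

end Bitableau

/-- Formal `K`-linear combinations of bitableaux. -/
abbrev BitableauComb (K : Type*) [Field K] (m n : ℕ) := Bitableau m n →₀ K

section

variable {K : Type*} [Field K] {m n : ℕ}

/-- The value in `K[X]` of a formal linear combination of bitableaux. -/
def BitableauComb.eval (f : BitableauComb K m n) : MvPolynomial (Fin m × Fin n) K :=
  f.sum fun Δ c => c • Bitableau.eval K Δ

/-- `f` is a representation of `p ∈ K[X]` as a linear combination of standard bitableaux. -/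
def IsStandardRepresentation (p : MvPolynomial (Fin m × Fin n) K) (f : BitableauComb K m n) :
    Prop :=
  (∀ Δ ∈ f.support, Δ.IsStandard) ∧ p = BitableauComb.eval f

/-- `r = ∑ x_i ε_i η_i` (with `x_i ≠ 0`) is the right hand side of a straightening relation
`γ δ = ∑ x_i ε_i η_i` in `K[X]`: each `ε_i η_i` is a standard bitableau with
`ε_i < γ, δ < η_i`, where the empty minor is allowed for `η_i`. -/
def IsStraighteningRelation (γ δ : NonemptyMinor m n) (r : BitableauComb K m n) : Prop :=
  γ.1.eval K * δ.1.eval K = BitableauComb.eval r ∧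
  ∀ Δ ∈ r.support, Δ.IsStandard ∧ ∃ (ε : NonemptyMinor m n) (η : Minor m n),
    Δ = {ε} + Bitableau.ofMinor η ∧ ε < γ ∧ ε < δ ∧ γ.1 < η ∧ δ.1 < η

/-- One application of a straightening relation: in a bitableau `γ δ Δ'` that occurs in `f` with
the coefficient `c ≠ 0` and for which `γ δ` is not standard, the product `γ δ` is replaced by the
right hand side `∑ x_i ε_i η_i` of a straightening relation, so that the term `c γ δ Δ'` of `f`
becomes `∑ c x_i ε_i η_i Δ'`. -/
def StraighteningStep (f g : BitableauComb K m n) : Prop :=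
  ∃ (γ δ : NonemptyMinor m n) (Δ' : Bitableau m n) (r : BitableauComb K m n),
    ¬ Bitableau.IsStandard {γ, δ} ∧ IsStraighteningRelation γ δ r ∧
    f ({γ, δ} + Δ') ≠ 0 ∧
    g = f.erase ({γ, δ} + Δ') + f ({γ, δ} + Δ') • r.mapDomain (fun Θ => Θ + Δ')

end

end StraighteningLaw

end

/-! A minor of `X` is a maximal minor of `(X | 1)`: unit vectors fill the rows outside it. For
determinants of `m` columns, an alternating map in more than `m` vectors of a free module of rank
`m` vanishes; this gives quadratic exchange relations (`tupleDet_mul_mem`). Used at an `x` where the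
first tuple has more entries above `x` than the second, they trade large entries of the first for
small ones of the second, so iteration ends at comparable pairs. Comparisons go through
`countAbove`, which ignores the order within a tuple and, for a suitable order of the columns of `(X
| 1)`, controls the order of minors. The outcome, `minor_mul_mem`, writes `γδ` in products `εη` with
`ε ≤ η`, `ε ≤ γ`, `δ ≤ η`.

Linear independence: substitute a product `UV` of generic matrices for `X`. The lex-leading monomial
of `[a | b]` becomes the product of the `u_{a_i i} v_{i b_i}`, so it records the position of every
index, and a standard bitableau can be recovered from its leading monomial
(`Bitableau.list_eq_of_leadingExponent_eq`).

The inequalities `ε ≤ δ` and `γ ≤ η` missing for (b) come from straightening `δγ` as well: by linear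
independence both results agree. For (c), an exponential weight drops in every relation, and the
multiset order on weights is well founded. A combination admitting no step is standard by (b);
termination then yields spanning, since monomials are bitableaux of `1 × 1` minors. -/

noncomputable section
namespace StraighteningLaw
open MvPolynomial

/-! ### Exchange relations and straightening for maximal minors. -/

section Garnir

/-- The alternating map in the variables from `P` obtained by fixing all other variables. -/
def restrictSlots {R V N κ : Type*} [CommRing R] [AddCommGroup V] [Module R V] [AddCommGroup N]
    [Module R N] [DecidableEq κ] (f : V [⋀^κ]→ₗ[R] N) (P : κ → Prop) [DecidablePred P]
    (z : κ → V) : V [⋀^{i // P i}]→ₗ[R] N :=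
  { f.toMultilinearMap.domDomRestrict P (fun i => z i) with
    map_eq_zero_of_eq' := by
      intro u i j hij hne
      refine f.map_eq_zero_of_eq _ (i := i.1) (j := j.1) ?_ (fun h => hne (Subtype.ext h))
      simp [i.2, j.2, hij] }

theorem restrictSlots_apply {R V N κ : Type*} [CommRing R] [AddCommGroup V] [Module R V]
    [AddCommGroup N] [Module R N] [DecidableEq κ] (f : V [⋀^κ]→ₗ[R] N) (P : κ → Prop)
    [DecidablePred P] (z : κ → V) (u : {i // P i} → V) :
    restrictSlots f P z u = f (fun i => if h : P i then u ⟨i, h⟩ else z i) := rfl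

/-- An alternating map in more variables than the rank of a free module vanishes. -/
theorem alternatingMap_eq_zero_of_card_lt {R N κ κ' : Type*} [CommRing R] [AddCommGroup N]
    [Module R N] [Fintype κ] [Fintype κ'] [DecidableEq κ'] [DecidableEq κ]
    (h : Fintype.card κ < Fintype.card κ') (f : (κ → R) [⋀^κ']→ₗ[R] N) : f = 0 := by
  refine (Pi.basisFun R κ).ext_alternating fun v hv => ?_
  exact absurd (Fintype.card_le_of_injective v hv) (not_le.2 h)

variable {R : Type*} [CommRing R] {ι : Type*} {m : ℕ}

/-- The number of entries of the tuple `v` that are greater than `x`. -/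
def countAbove [LinearOrder ι] (v : Fin m → ι) (x : ι) : ℕ :=
  (Finset.univ.filter fun i => x < v i).card

/-- The determinant whose rows are the vectors `y (v i)`. -/
def tupleDet (y : ι → Fin m → R) (v : Fin m → ι) : R := Matrix.det (Matrix.of fun i => y (v i))

/-- The entries of `z` that are selected by the slots of `P`, the other slots are left as in `v`. -/
def fillSlots (P : Fin m → Prop) [DecidablePred P] (z : {i // P i} → ι) (v : Fin m → ι) :
    Fin m → ι := fun i => if h : P i then z ⟨i, h⟩ else v i

theorem restrictSlots_det (y : ι → Fin m → R) (P : Fin m → Prop) [DecidablePred P]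
    (z : {i // P i} → ι) (v : Fin m → ι) :
    restrictSlots Matrix.detRowAlternating P (y ∘ v) (y ∘ z) = tupleDet y (fillSlots P z v) := by
  rw [restrictSlots_apply, tupleDet]
  change Matrix.det _ = Matrix.det _
  congr 1
  ext i j
  simp only [fillSlots, Matrix.of_apply, Function.comp]
  split_ifs <;> rfl

/-- The first tuple after the exchange of the entries of `v` in the slots `P` with the entries of
`w` in the slots `Q` prescribed by `σ`. -/
def exchangeLeft (v w : Fin m → ι) (P Q : Fin m → Prop) [DecidablePred P]
    (σ : Equiv.Perm ({i // P i} ⊕ {i // Q i})) : Fin m → ι :=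
  fillSlots P (fun i => Sum.elim (fun i : {i // P i} => v i) (fun j : {i // Q i} => w j)
    (σ (Sum.inl i))) v

/-- The second tuple after the exchange of the entries of `v` in the slots `P` with the entries of
`w` in the slots `Q` prescribed by `σ`. -/
def exchangeRight (v w : Fin m → ι) (P Q : Fin m → Prop) [DecidablePred Q]
    (σ : Equiv.Perm ({i // P i} ⊕ {i // Q i})) : Fin m → ι :=
  fillSlots Q (fun i => Sum.elim (fun i : {i // P i} => v i) (fun j : {i // Q i} => w j)
    (σ (Sum.inr i))) w

/-- The Garnir relation: exchanging the entries of `v` in the slots `P` with the entries of `w` in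
the slots `Q` in all nontrivial ways. -/
theorem tupleDet_mul_mem (y : ι → Fin m → R) (v w : Fin m → ι) (P Q : Fin m → Prop)
    [DecidablePred P] [DecidablePred Q]
    (h : m < Fintype.card {i // P i} + Fintype.card {i // Q i}) (N : AddSubgroup R)
    (hN : ∀ σ : Equiv.Perm ({i // P i} ⊕ {i // Q i}), (∃ i j, σ (Sum.inl i) = Sum.inr j) →
      tupleDet y (exchangeLeft v w P Q σ) * tupleDet y (exchangeRight v w P Q σ) ∈ N) :
    tupleDet y v * tupleDet y w ∈ N := by
  classical
  set f := restrictSlots (Matrix.detRowAlternating (R := R) (n := Fin m)) P (y ∘ v)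
  set g := restrictSlots (Matrix.detRowAlternating (R := R) (n := Fin m)) Q (y ∘ w)
  set z : {i // P i} ⊕ {i // Q i} → ι := Sum.elim (fun i => v i) (fun j => w j) with hz
  set s : Equiv.Perm.ModSumCongr {i // P i} {i // Q i} → R := fun q =>
    LinearMap.mul' R R (AlternatingMap.domCoprod.summand f g q (y ∘ z)) with hs
  have hsum : ∑ q, s q = 0 := by
    -- `domCoprod` is the signed sum over the permutations of all slots modulo those preserving both
    -- groups of slots; by `h` it is alternating in more than `m` vectors.
    have h0 : f.domCoprod g = 0 := alternatingMap_eq_zero_of_card_lt (by simpa using h) _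
    have h1 := congrArg (fun F => LinearMap.mul' R R (F (y ∘ z))) h0
    simpa [AlternatingMap.domCoprod_apply, hs] using h1
  have hval : ∀ σ : Equiv.Perm ({i // P i} ⊕ {i // Q i}), s (Quotient.mk'' σ) =
      Equiv.Perm.sign σ • (tupleDet y (exchangeLeft v w P Q σ) *
        tupleDet y (exchangeRight v w P Q σ)) := by
    intro σ
    rw [exchangeLeft, exchangeRight, ← restrictSlots_det, ← restrictSlots_det]
    simp only [hs, AlternatingMap.domCoprod.summand_mk'']
    rw [smul_apply, MultilinearMap.domDomCongr_apply, MultilinearMap.domCoprod_apply]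
    rw [Units.smul_def, Units.smul_def, map_zsmul, LinearMap.mul'_apply]
    rfl
  have h1 : s (Quotient.mk'' 1) = tupleDet y v * tupleDet y w := by
    have e1 : exchangeLeft v w P Q 1 = v := by ext i; simp [exchangeLeft, fillSlots]
    have e2 : exchangeRight v w P Q 1 = w := by ext i; simp [exchangeRight, fillSlots]
    rw [hval, e1, e2, Equiv.Perm.sign_one, one_smul]
  rw [← h1]
  have hsum' := Finset.add_sum_erase _ s (Finset.mem_univ (Quotient.mk'' 1))
  rw [hsum] at hsum'
  rw [eq_neg_of_add_eq_zero_left hsum']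
  refine N.neg_mem (N.sum_mem fun q hq => ?_)
  induction q using Quotient.inductionOn' with | _ σ
  rw [hval, Units.smul_def]
  refine N.zsmul_mem (hN σ ?_) _
  -- A `σ` that moves no slot of `P` into `Q` lies in the subgroup, so its coset is the one of the
  -- identity, which was removed from the sum.
  by_contra hcon
  push Not at hcon
  refine (Finset.mem_erase.1 hq).1 (Quotient.sound' ?_)
  rw [QuotientGroup.leftRel_apply, mul_one]
  refine inv_mem (Equiv.Perm.mem_sumCongrHom_range_of_perm_mapsTo_inl ?_)
  rintro _ ⟨i, rfl⟩
  rcases hx : σ (Sum.inl i) with a | b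
  · exact ⟨a, rfl⟩
  · exact absurd hx (hcon i b)

variable [LinearOrder ι]

/-- For `t < x` the slots that change were all counted before. For `t ≥ x` an entry above `t` cannot
come from `w`, so `σ` injects the new entries above `t` into the old ones. -/
theorem countAbove_exchangeLeft_le (v w : Fin m → ι) (x : ι)
    (σ : Equiv.Perm ({i // x < v i} ⊕ {i // w i ≤ x})) (t : ι) :
    countAbove (exchangeLeft v w (x < v ·) (w · ≤ x) σ) t ≤ countAbove v t := by
  rcases lt_or_ge t x with htx | htx
  · refine Finset.card_le_card fun i => ?_
    simp only [Finset.mem_filter, Finset.mem_univ, true_and, exchangeLeft, fillSlots]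
    split_ifs with h
    · exact fun _ => htx.trans h
    · exact id
  · refine Finset.card_le_card_of_forall_subsingleton
      (fun i i' => ∃ h h', σ (Sum.inl ⟨i, h⟩) = Sum.inl ⟨i', h'⟩) (fun i => ?_) ?_
    · simp only [Finset.mem_filter, Finset.mem_univ, true_and, exchangeLeft, fillSlots]
      split_ifs with h
      · intro hi
        rcases hσ : σ (Sum.inl ⟨i, h⟩) with a | b
        · rw [hσ] at hi
          exact ⟨a, hi, h, a.2, hσ⟩
        · rw [hσ] at hi
          exact absurd (lt_of_lt_of_le hi b.2) (not_lt.2 htx)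
      · exact fun hi => absurd (htx.trans_lt hi) h
    · rintro b - i ⟨-, _, _, hi⟩ j ⟨-, _, _, hj⟩
      simpa using hi.trans hj.symm

theorem countAbove_exchangeLeft_lt (v w : Fin m → ι) (x : ι)
    (σ : Equiv.Perm ({i // x < v i} ⊕ {i // w i ≤ x}))
    (hσ : ∃ i j, σ (Sum.inl i) = Sum.inr j) :
    countAbove (exchangeLeft v w (x < v ·) (w · ≤ x) σ) x < countAbove v x := by
  obtain ⟨i, j, hij⟩ := hσ
  refine Finset.card_lt_card ?_
  rw [Finset.ssubset_iff_of_subset]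
  · refine ⟨i, by simpa using i.2, ?_⟩
    simp [exchangeLeft, fillSlots, i.2, hij, j.2]
  · intro k
    simp only [Finset.mem_filter, Finset.mem_univ, true_and, exchangeLeft, fillSlots]
    split_ifs with h
    · exact fun _ => h
    · exact id

theorem card_filter_le_add_countAbove (v : Fin m → ι) (x : ι) :
    (Finset.univ.filter fun i => v i ≤ x).card + countAbove v x = m := by
  have := Finset.card_filter_add_card_filter_not (s := (Finset.univ : Finset (Fin m)))
    (fun i => v i ≤ x)
  simpa [countAbove] using this

/-- Mirror image of `countAbove_exchangeLeft_le`; for `t < x` the injection is between the entries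
that are at most `t`. -/
theorem le_countAbove_exchangeRight (v w : Fin m → ι) (x : ι)
    (σ : Equiv.Perm ({i // x < v i} ⊕ {i // w i ≤ x})) (t : ι) :
    countAbove w t ≤ countAbove (exchangeRight v w (x < v ·) (w · ≤ x) σ) t := by
  rcases le_or_gt x t with htx | htx
  · refine Finset.card_le_card fun i => ?_
    simp only [Finset.mem_filter, Finset.mem_univ, true_and, exchangeRight, fillSlots]
    split_ifs with h
    · exact fun hi => absurd (htx.trans_lt hi) (not_lt.2 h)
    · exact id
  · have h1 := card_filter_le_add_countAbove w t
    have h2 := card_filter_le_add_countAbove (exchangeRight v w (x < v ·) (w · ≤ x) σ) t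
    suffices hle : (Finset.univ.filter fun i =>
        exchangeRight v w (x < v ·) (w · ≤ x) σ i ≤ t).card ≤
        (Finset.univ.filter fun i => w i ≤ t).card by omega
    refine Finset.card_le_card_of_forall_subsingleton
      (fun i i' => ∃ h h', σ (Sum.inr ⟨i, h⟩) = Sum.inr ⟨i', h'⟩) (fun i => ?_) ?_
    · simp only [Finset.mem_filter, Finset.mem_univ, true_and, exchangeRight, fillSlots]
      split_ifs with h
      · intro hi
        rcases hσ : σ (Sum.inr ⟨i, h⟩) with a | b
        · rw [hσ] at hi
          exact absurd (lt_of_lt_of_le a.2 hi) (not_lt.2 htx.le)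
        · rw [hσ] at hi
          exact ⟨b, hi, h, b.2, hσ⟩
      · exact fun hi => absurd (hi.trans htx.le) h
    · rintro b - i ⟨-, _, _, hi⟩ j ⟨-, _, _, hj⟩
      simpa using hi.trans hj.symm

/-- Straightening of products of maximal minors. -/
theorem tupleDet_mul_mem_of_forall [Fintype ι] (y : ι → Fin m → R) (v w : Fin m → ι)
    (N : AddSubgroup R)
    (hN : ∀ v' w' : Fin m → ι, countAbove v' ≤ countAbove w' → countAbove v' ≤ countAbove v →
      countAbove w ≤ countAbove w' → tupleDet y v' * tupleDet y w' ∈ N) :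
    tupleDet y v * tupleDet y w ∈ N := by
  by_cases hle : countAbove v ≤ countAbove w
  · exact hN v w hle le_rfl le_rfl
  · obtain ⟨x, hx⟩ : ∃ x, countAbove w x < countAbove v x := by
      simpa [Pi.le_def] using hle
    -- The chosen slots number `countAbove v x + (m - countAbove w x)`, which exceeds `m` by the
    -- choice of `x`.
    refine tupleDet_mul_mem y v w (x < v ·) (w · ≤ x) ?_ N fun σ hσ => ?_
    · have := card_filter_le_add_countAbove w x
      rw [Fintype.card_subtype, Fintype.card_subtype]
      change m < countAbove v x + _
      omega
    · have h1 := countAbove_exchangeLeft_le v w x σ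
      have h2 := le_countAbove_exchangeRight v w x σ
      have h3 : ∑ t, countAbove (exchangeLeft v w (x < v ·) (w · ≤ x) σ) t <
          ∑ t, countAbove v t :=
        Finset.sum_lt_sum (fun t _ => h1 t)
          ⟨x, Finset.mem_univ _, countAbove_exchangeLeft_lt v w x σ hσ⟩
      exact tupleDet_mul_mem_of_forall y _ _ N fun v' w' hvw hv hw =>
        hN v' w' hvw (hv.trans h1) (le_trans h2 hw)
termination_by ∑ t, countAbove v t

end Garnir

/-! ### From minors of `X` to maximal minors of `(X | 1)`. -/

section Transfer

variable {m n : ℕ}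

namespace Minor

/-- The minor `δ` as a maximal minor of the matrix `(X | 1)`, whose columns are indexed by
`Fin n ⊕ₗ (Fin m)ᵒᵈ`: a column of `X` for each row of `δ` and a unit vector for each other row. -/
def tuple (δ : Minor m n) (i : Fin m) : Fin n ⊕ₗ (Fin m)ᵒᵈ :=
  if h : i ∈ δ.rows then Sum.inlₗ (δ.col ((δ.rows.orderIsoOfFin rfl).symm ⟨i, h⟩))
  else Sum.inrₗ (OrderDual.toDual i)

theorem row_mem (δ : Minor m n) (k : Fin δ.size) : δ.row k ∈ δ.rows := (δ.mem_rows _).2 ⟨k, rfl⟩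

theorem col_mem (δ : Minor m n) (k : Fin δ.size) : δ.col k ∈ δ.cols := (δ.mem_cols _).2 ⟨k, rfl⟩

theorem tuple_row (δ : Minor m n) (k : Fin δ.size) : δ.tuple (δ.row k) = Sum.inlₗ (δ.col k) := by
  rw [tuple, dif_pos (δ.row_mem k)]
  congr 2
  exact (OrderIso.symm_apply_eq _).2 rfl

theorem tuple_of_notMem (δ : Minor m n) {i : Fin m} (h : i ∉ δ.rows) :
    δ.tuple i = Sum.inrₗ (OrderDual.toDual i) := dif_neg h

theorem tuple_injective (δ : Minor m n) : Function.Injective δ.tuple := by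
  intro i j hij
  by_cases hi : i ∈ δ.rows <;> by_cases hj : j ∈ δ.rows
  · obtain ⟨k, rfl⟩ := (δ.mem_rows i).1 hi
    obtain ⟨l, rfl⟩ := (δ.mem_rows j).1 hj
    rw [tuple_row, tuple_row] at hij
    rw [δ.col.injective (Sum.inl_injective (toLex.injective hij))]
  · obtain ⟨k, rfl⟩ := (δ.mem_rows i).1 hi
    rw [tuple_row, tuple_of_notMem _ hj] at hij
    exact absurd (toLex.injective hij) Sum.inl_ne_inr
  · obtain ⟨l, rfl⟩ := (δ.mem_rows j).1 hj
    rw [tuple_row, tuple_of_notMem _ hi] at hij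
    exact absurd (toLex.injective hij) Sum.inr_ne_inl
  · rw [tuple_of_notMem _ hj, tuple_of_notMem _ hi] at hij
    exact OrderDual.toDual.injective (Sum.inr_injective (toLex.injective hij))

/-- Unit vectors lie above all columns of `X`, so the entries of the tuple up to column `j` are
exactly the columns of `δ` up to `j`. -/
theorem card_col_le_add_countAbove (δ : Minor m n) (j : Fin n) :
    (Finset.univ.filter fun k => δ.col k ≤ j).card + countAbove δ.tuple (Sum.inlₗ j) = m := by
  refine Eq.trans ?_ (card_filter_le_add_countAbove δ.tuple (Sum.inlₗ j))
  rw [add_left_inj, ← Finset.card_map δ.row.toEmbedding]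
  congr 1
  ext i
  simp only [Finset.mem_map, Finset.mem_filter, Finset.mem_univ, true_and]
  by_cases hi : i ∈ δ.rows
  · obtain ⟨k, rfl⟩ := (δ.mem_rows i).1 hi
    rw [tuple_row, Sum.Lex.inl_le_inl_iff]
    exact ⟨fun ⟨l, hl, h⟩ => δ.row.injective h ▸ hl, fun h => ⟨k, h, rfl⟩⟩
  · rw [tuple_of_notMem _ hi]
    refine ⟨fun ⟨l, _, h⟩ => absurd (h ▸ δ.row_mem l) hi, fun h => ?_⟩
    exact absurd h Sum.Lex.not_inr_le_inl

/-- As the unit vectors are ordered in reverse, the entries above the one with index `r` are those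
with index `i < r` outside `δ.rows`. Together with the rows of `δ` below `r` they exhaust the `r`
indices below `r`. -/
theorem card_row_lt_add_countAbove (δ : Minor m n) (r : Fin m) :
    (Finset.univ.filter fun k => δ.row k < r).card +
      countAbove δ.tuple (Sum.inrₗ (OrderDual.toDual r)) = r := by
  rw [← Fin.card_Iio r, ← Finset.card_filter_add_card_filter_not (s := Finset.Iio r) (· ∈ δ.rows),
    ← Finset.card_map δ.row.toEmbedding, countAbove]
  congr 2
  · ext i
    simp only [Finset.mem_map, Finset.mem_filter, Finset.mem_univ, true_and, Finset.mem_Iio,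
      mem_rows]
    exact ⟨fun ⟨l, hl, h⟩ => h ▸ ⟨hl, l, rfl⟩, fun ⟨h, l, hl⟩ => ⟨l, hl ▸ h, hl⟩⟩
  · ext i
    simp only [Finset.mem_filter, Finset.mem_univ, true_and, Finset.mem_Iio]
    by_cases hi : i ∈ δ.rows
    · obtain ⟨k, rfl⟩ := (δ.mem_rows i).1 hi
      rw [tuple_row]
      exact ⟨fun h => absurd h Sum.Lex.not_inr_lt_inl, fun h => absurd hi h.2⟩
    · rw [tuple_of_notMem _ hi, Sum.Lex.inr_lt_inr_iff, OrderDual.toDual_lt_toDual]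
      exact ⟨fun h => ⟨h, hi⟩, fun h => h.1⟩

/-- The two preceding counts turn the hypothesis into a comparison of the counting functions of rows
and columns, which is the entrywise comparison of increasing sequences. -/
theorem le_of_countAbove_tuple_le {γ δ : Minor m n}
    (h : countAbove γ.tuple ≤ countAbove δ.tuple) : γ ≤ δ := by
  have hcol : ∀ j, (Finset.univ.filter fun k => δ.col k ≤ j).card ≤
      (Finset.univ.filter fun k => γ.col k ≤ j).card := fun j => by
    have h1 := γ.card_col_le_add_countAbove j
    have h2 := δ.card_col_le_add_countAbove j
    have h3 : countAbove γ.tuple (Sum.inlₗ j) ≤ countAbove δ.tuple (Sum.inlₗ j) := h _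
    omega
  have hrow : ∀ r, (Finset.univ.filter fun k => δ.row k < r).card ≤
      (Finset.univ.filter fun k => γ.row k < r).card := fun r => by
    have h1 := γ.card_row_lt_add_countAbove r
    have h2 := δ.card_row_lt_add_countAbove r
    have h3 : countAbove γ.tuple (Sum.inrₗ (OrderDual.toDual r)) ≤
        countAbove δ.tuple (Sum.inrₗ (OrderDual.toDual r)) := h _
    omega
  have hsize : δ.size ≤ γ.size := by
    rcases Nat.eq_zero_or_pos δ.size with h0 | h0
    · omega
    -- The last column of `δ` as threshold counts all columns of `δ`.
    · have h1 := hcol (δ.col ⟨δ.size - 1, by omega⟩)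
      rw [Finset.filter_true_of_mem, Finset.card_univ, Fintype.card_fin] at h1
      · exact h1.trans ((Finset.card_le_univ _).trans (by simp))
      · intro k _
        exact δ.col.monotone (Fin.le_def.2 (by have := k.2; simp only; omega))
  refine ⟨hsize, fun i => ⟨?_, ?_⟩⟩
  · by_contra hlt
    rw [not_le] at hlt
    -- Below this threshold lie at least `i + 1` rows of `δ`, but only `i` rows of `γ`.
    have h1 := hrow (γ.row (Fin.castLE hsize i))
    simp only [OrderEmbedding.lt_iff_lt] at h1
    have h2 : (Finset.Iic i) ⊆ Finset.univ.filter fun k => δ.row k < γ.row (Fin.castLE hsize i) :=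
      fun k hk => by
        simpa using (δ.row.monotone (Finset.mem_Iic.1 hk)).trans_lt hlt
    have h3 := Finset.card_le_card h2
    have h4 : (Finset.univ.filter fun k => k < Fin.castLE hsize i).card = i := by
      rw [← Fin.val_castLE hsize i, ← Fin.card_Iio]
      congr 1; ext; simp
    rw [Fin.card_Iic] at h3
    omega
  · by_contra hlt
    rw [not_le] at hlt
    have h1 := hcol (δ.col i)
    simp only [OrderEmbedding.le_iff_le] at h1
    have h2 : (Finset.univ.filter fun k => γ.col k ≤ δ.col i) ⊆ Finset.Iio (Fin.castLE hsize i) :=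
      fun k hk => by
        simp only [Finset.mem_filter, Finset.mem_univ, true_and] at hk
        exact Finset.mem_Iio.2 (γ.col.lt_iff_lt.1 (hk.trans_lt hlt))
    have h3 := Finset.card_le_card h2
    have h4 : (Finset.univ.filter fun k => k ≤ i).card = i + 1 := by
      rw [← Fin.card_Iic]
      congr 1; ext; simp
    rw [Fin.card_Iio, Fin.val_castLE] at h3
    omega

end Minor

/-- The columns of the matrix `(X | 1)`. -/
def extendedColumn (K : Type*) [Field K] (m n : ℕ) (c : Fin n ⊕ₗ (Fin m)ᵒᵈ) :
    Fin m → MvPolynomial (Fin m × Fin n) K :=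
  Sum.elim (fun j i => X (i, j)) (fun r => Pi.single (OrderDual.ofDual r) 1) (ofLex c)

/-- The enumeration of the rows of a minor. -/
def Minor.rowEquiv (δ : Minor m n) : Fin δ.size ≃ {i // i ∈ δ.rows} :=
  Equiv.ofBijective (fun k => ⟨δ.row k, δ.row_mem k⟩)
    ⟨fun _ _ h => δ.row.injective (congrArg Subtype.val h),
      fun ⟨i, hi⟩ => ((δ.mem_rows i).1 hi).imp fun _ hk => Subtype.ext hk⟩

/-- The determinant of a principal submatrix in terms of an enumeration of its index set. -/
theorem det_toSquareBlockProp {R κ κ' : Type*} [CommRing R] [Fintype κ] [DecidableEq κ]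
    [Fintype κ'] [DecidableEq κ'] (M : Matrix κ κ R) (P : κ → Prop) [DecidablePred P]
    (e : κ' ≃ {i // P i}) :
    (M.toSquareBlockProp P).det = (Matrix.of fun k l => M (e k) (e l)).det :=
  (Matrix.det_submatrix_equiv_self e (M.toSquareBlockProp P)).symm

/-- The matrix is block triangular, with an identity block for the rows outside `δ`. The other block
is the transpose of the matrix of the minor, since columns of `X` serve as rows in `tupleDet`. -/
theorem tupleDet_tuple (K : Type*) [Field K] (δ : Minor m n) :
    tupleDet (extendedColumn K m n) δ.tuple = δ.eval K := by
  rw [tupleDet, Matrix.twoBlockTriangular_det _ (· ∈ δ.rows)]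
  · have h1 : Matrix.toSquareBlockProp (Matrix.of fun i => extendedColumn K m n (δ.tuple i))
        (fun i => ¬ i ∈ δ.rows) = 1 := by
      ext1 i j
      rw [Matrix.toSquareBlockProp_def, Matrix.of_apply, Matrix.of_apply,
        Minor.tuple_of_notMem _ i.2]
      simp [extendedColumn, Matrix.one_apply, Pi.single_apply, Subtype.ext_iff, eq_comm]
    rw [h1, Matrix.det_one, mul_one, Minor.eval]
    refine (det_toSquareBlockProp _ (· ∈ δ.rows) δ.rowEquiv).trans ?_
    rw [← Matrix.det_transpose]
    refine congrArg Matrix.det (Matrix.ext fun i j => ?_)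
    change extendedColumn K m n (δ.tuple (δ.row j)) (δ.row i) = X (δ.row i, δ.col j)
    rw [Minor.tuple_row]
    rfl
  · intro i hi j hj
    rw [Matrix.of_apply, Minor.tuple_of_notMem _ hi]
    exact Pi.single_eq_of_ne (fun h : j = i => hi (h ▸ hj)) _

/-- An injective tuple is, up to order, the tuple of a minor. -/
theorem exists_tuple_comp_eq {v : Fin m → Fin n ⊕ₗ (Fin m)ᵒᵈ} (hv : Function.Injective v) :
    ∃ (δ : Minor m n) (π : Equiv.Perm (Fin m)), v = δ.tuple ∘ π := by
  classical
  set S : Finset (Fin n ⊕ (Fin m)ᵒᵈ) := Finset.univ.image (fun i => ofLex (v i)) with hS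
  have hcard : S.card = m := by
    exact (Finset.card_image_of_injective _ (ofLex.injective.comp hv)).trans (by simp)
  have hadd := S.card_toLeft_add_card_toRight
  -- The rows are those whose unit vector is not chosen; the cardinalities fit because `m` columns
  -- are chosen altogether.
  set δ : Minor m n := ⟨(S.toRight.map OrderDual.ofDual.toEmbedding)ᶜ, S.toLeft, by
    rw [Finset.card_compl, Finset.card_map, Fintype.card_fin]; omega⟩ with hδ
  have hmem : ∀ i, ofLex (δ.tuple i) ∈ S := by
    intro i
    by_cases hi : i ∈ δ.rows
    · obtain ⟨k, rfl⟩ := (δ.mem_rows i).1 hi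
      rw [Minor.tuple_row]
      exact Finset.mem_toLeft.1 (δ.col_mem k)
    · rw [Minor.tuple_of_notMem _ hi]
      simp only [hδ, Finset.mem_compl, not_not, Finset.mem_map, Finset.mem_toRight] at hi
      obtain ⟨a, ha, rfl⟩ := hi
      exact ha
  have himage : Finset.univ.image (fun i => ofLex (δ.tuple i)) = S := by
    refine Finset.eq_of_subset_of_card_le (fun x hx => ?_) ?_
    · obtain ⟨i, -, rfl⟩ := Finset.mem_image.1 hx
      exact hmem i
    · refine hcard.trans_le (Eq.ge ?_)
      exact (Finset.card_image_of_injective _ (ofLex.injective.comp δ.tuple_injective)).trans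
        (by simp)
  have hex : ∀ i, ∃ j, δ.tuple j = v i := by
    intro i
    have : ofLex (v i) ∈ S := Finset.mem_image_of_mem _ (Finset.mem_univ i)
    rw [← himage] at this
    obtain ⟨j, -, hj⟩ := Finset.mem_image.1 this
    exact ⟨j, ofLex.injective hj⟩
  choose π hπ using hex
  have hinj : Function.Injective π := fun i j hij => hv (by rw [← hπ, ← hπ, hij])
  exact ⟨δ, Equiv.ofBijective π (Finite.injective_iff_bijective.1 hinj),
    funext fun i => (hπ i).symm⟩

theorem countAbove_comp_perm {ι : Type*} [LinearOrder ι] (v : Fin m → ι)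
    (π : Equiv.Perm (Fin m)) : countAbove (v ∘ π) = countAbove v := by
  ext x
  exact Finset.card_equiv π (by simp)

theorem tupleDet_comp_perm {R ι : Type*} [CommRing R] (y : ι → Fin m → R) (v : Fin m → ι)
    (π : Equiv.Perm (Fin m)) : tupleDet y (v ∘ π) = Equiv.Perm.sign π • tupleDet y v := by
  rw [Units.smul_def, zsmul_eq_mul]
  exact Matrix.det_permute π (Matrix.of fun i => y (v i))

/-- The straightening procedure for the product of two minors. -/
theorem minor_mul_mem {K : Type*} [Field K] (γ δ : Minor m n)
    (N : AddSubgroup (MvPolynomial (Fin m × Fin n) K))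
    (hN : ∀ ε η : Minor m n, ε ≤ η → ε ≤ γ → δ ≤ η → ε.eval K * η.eval K ∈ N) :
    γ.eval K * δ.eval K ∈ N := by
  rw [← tupleDet_tuple, ← tupleDet_tuple]
  have h0 : ∀ v : Fin m → Fin n ⊕ₗ (Fin m)ᵒᵈ, ¬ Function.Injective v →
      tupleDet (extendedColumn K m n) v = 0 := by
    intro v hv
    simp only [Function.Injective, not_forall] at hv
    obtain ⟨i, j, hij, hne⟩ := hv
    exact Matrix.det_zero_of_row_eq hne (by ext; simp [hij])
  refine tupleDet_mul_mem_of_forall _ _ _ N fun v w hvw hv hw => ?_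
  by_cases hvi : Function.Injective v
  · by_cases hwi : Function.Injective w
    · obtain ⟨ε, π, rfl⟩ := exists_tuple_comp_eq hvi
      obtain ⟨η, ρ, rfl⟩ := exists_tuple_comp_eq hwi
      rw [countAbove_comp_perm] at hv hw hvw
      rw [countAbove_comp_perm] at hvw
      rw [tupleDet_comp_perm, tupleDet_comp_perm, tupleDet_tuple, tupleDet_tuple, Units.smul_def,
        Units.smul_def, smul_mul_smul_comm]
      exact N.zsmul_mem (hN ε η (Minor.le_of_countAbove_tuple_le hvw)
        (Minor.le_of_countAbove_tuple_le hv) (Minor.le_of_countAbove_tuple_le hw)) _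
    · rw [h0 w hwi, mul_zero]
      exact N.zero_mem
  · rw [h0 v hvi, zero_mul]
    exact N.zero_mem

end Transfer

/-! ### Linear independence through leading monomials. -/

section LinearIndependence

/-- Polynomials with pairwise different degrees are linearly independent. -/
theorem linearIndependent_of_degree_injective {K σ I : Type*} [Field K] (ord : MonomialOrder σ)
    (p : I → MvPolynomial σ K) (h0 : ∀ i, p i ≠ 0)
    (hp : Function.Injective fun i => ord.degree (p i)) : LinearIndependent K p := by
  classical
  rw [linearIndependent_iff']
  intro s g hsum
  by_contra hcon
  push Not at hcon
  obtain ⟨j, hj, hgj⟩ := hcon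
  -- Among the terms with nonzero coefficient, the one of largest degree cannot have its leading
  -- monomial cancelled.
  obtain ⟨i, hi, hmax⟩ := (s.filter (g · ≠ 0)).exists_max_image
    (fun i => ord.toSyn (ord.degree (p i))) ⟨j, Finset.mem_filter.2 ⟨hj, hgj⟩⟩
  have h1 := congrArg (coeff (ord.degree (p i))) hsum
  rw [coeff_sum, coeff_zero, Finset.sum_eq_single i] at h1
  · rw [coeff_smul, smul_eq_mul, mul_eq_zero] at h1
    exact h1.elim (Finset.mem_filter.1 hi).2 ((ord.coeff_degree_ne_zero_iff).2 (h0 i))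
  · intro k hk hki
    by_cases hgk : g k = 0
    · rw [hgk, zero_smul, coeff_zero]
    · have hle := hmax k (Finset.mem_filter.2 ⟨hk, hgk⟩)
      rw [coeff_smul, ord.coeff_eq_zero_of_lt (lt_of_le_of_ne hle fun h => hki
        (hp (ord.toSyn.injective h))), smul_zero]
  · exact fun h => absurd (Finset.mem_filter.1 hi).1 h

variable {m n : ℕ}

/-- Index set for the entries of a generic `m × m` matrix and a generic `m × n` matrix; the entries
are ordered such that those of the first matrix come first and go column by column, and those
of the second matrix go row by row. -/
abbrev FactorVar (m n : ℕ) : Type := (Fin m ×ₗ Fin m) ⊕ₗ (Fin m ×ₗ Fin n)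

instance (m n : ℕ) : Finite (FactorVar m n) := inferInstanceAs (Finite (_ ⊕ (_ × _)))

/-- The entry in column `k` and row `a` of the left factor. -/
def leftVar (k a : Fin m) : FactorVar m n := toLex (Sum.inl (toLex (k, a)))

/-- The entry in row `k` and column `b` of the right factor. -/
def rightVar (k : Fin m) (b : Fin n) : FactorVar m n := toLex (Sum.inr (toLex (k, b)))

theorem leftVar_inj {k k' a a' : Fin m} :
    (leftVar k a : FactorVar m n) = leftVar k' a' ↔ k = k' ∧ a = a' := by
  simp [leftVar]

theorem rightVar_inj {k k' : Fin m} {b b' : Fin n} :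
    rightVar k b = rightVar k' b' ↔ k = k' ∧ b = b' := by
  simp [rightVar]

theorem leftVar_ne_rightVar {k k' a : Fin m} {b : Fin n} : leftVar k a ≠ rightVar k' b :=
  fun h => Sum.inl_ne_inr (toLex.injective h)

/-- The substitution that replaces the generic matrix by a product of two generic matrices. -/
def factorHom (K : Type*) [Field K] (m n : ℕ) :
    MvPolynomial (Fin m × Fin n) K →ₐ[K] MvPolynomial (FactorVar m n) K :=
  aeval fun p => ∑ k, X (leftVar k p.1) * X (rightVar k p.2)

namespace Minor

/-- The exponent of `∏ u (row i) (c i) * v (c i) (d i)`. -/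
def factorExponent (δ : Minor m n) (c : Fin δ.size → Fin m) (d : Fin δ.size → Fin n) :
    FactorVar m n →₀ ℕ :=
  ∑ i, (Finsupp.single (leftVar (c i) (δ.row i)) 1 + Finsupp.single (rightVar (c i) (d i)) 1)

theorem factorExponent_leftVar (δ : Minor m n) (c : Fin δ.size → Fin m) (d : Fin δ.size → Fin n)
    (k a : Fin m) :
    δ.factorExponent c d (leftVar k a) = ∑ i, if c i = k ∧ δ.row i = a then 1 else 0 := by
  classical
  rw [factorExponent, Finsupp.finsetSum_apply]
  refine Finset.sum_congr rfl fun i _ => ?_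
  rw [Finsupp.add_apply, Finsupp.single_apply, Finsupp.single_apply,
    if_neg leftVar_ne_rightVar.symm, add_zero]
  simp only [leftVar_inj]

theorem factorExponent_rightVar (δ : Minor m n) (c : Fin δ.size → Fin m) (d : Fin δ.size → Fin n)
    (k : Fin m) (b : Fin n) :
    δ.factorExponent c d (rightVar k b) = ∑ i, if c i = k ∧ d i = b then 1 else 0 := by
  classical
  rw [factorExponent, Finsupp.finsetSum_apply]
  refine Finset.sum_congr rfl fun i _ => ?_
  rw [Finsupp.add_apply, Finsupp.single_apply, Finsupp.single_apply,
    if_neg leftVar_ne_rightVar, zero_add]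
  simp only [rightVar_inj]

theorem size_le (δ : Minor m n) : δ.size ≤ m := by
  exact δ.rows.card_le_univ.trans (by simp)

/-- The exponent of the leading monomial of a minor after the substitution. -/
def leadingExponent (δ : Minor m n) : FactorVar m n →₀ ℕ :=
  δ.factorExponent (Fin.castLE δ.size_le) δ.col

/-- In the lex order the first differing variable decides. If `c` is not the inclusion, it is the
left variable at the first `i` with `c i ≠ i`: by injectivity of `c`, the columns before `i` agree.
Otherwise it is the right variable at the first `i` moved by `π`. In both cases the exponent there
is positive for the leading monomial and `0` for the other. -/
theorem factorExponent_lt (δ : Minor m n) {c : Fin δ.size → Fin m} (hc : Function.Injective c)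
    (π : Equiv.Perm (Fin δ.size)) (hne : ¬ (c = Fin.castLE δ.size_le ∧ π = 1)) :
    toLex (δ.factorExponent c (δ.col ∘ π)) < toLex δ.leadingExponent := by
  rw [Finsupp.Lex.lt_iff]
  by_cases hcκ : c = Fin.castLE δ.size_le
  · have hex : ∃ i, π i ≠ i := by
      by_contra hcon
      push Not at hcon
      exact hne ⟨hcκ, Equiv.ext hcon⟩
    obtain ⟨i, hi, hmin⟩ := WellFounded.has_min (wellFounded_lt (α := Fin δ.size)) _ hex
    have hlt : ∀ l, l < i → π l = l := fun l hl => by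
      by_contra h
      exact hmin l h hl
    refine ⟨rightVar (Fin.castLE δ.size_le i) (δ.col i), fun y hy => ?_, ?_⟩
    · change δ.factorExponent _ _ y = δ.factorExponent _ _ y
      obtain ⟨⟨k, a⟩ | ⟨k, b⟩, rfl⟩ := toLex.surjective y
      · rw [← hcκ]
        exact (factorExponent_leftVar ..).trans (factorExponent_leftVar ..).symm
      · refine (factorExponent_rightVar ..).trans (Eq.trans ?_ (factorExponent_rightVar ..).symm)
        refine Finset.sum_congr rfl fun j _ => ?_
        simp only [hcκ, Function.comp]
        congr 1
        rw [eq_iff_iff, and_congr_right_iff]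
        rintro rfl
        rcases Prod.Lex.toLex_lt_toLex.1 (Sum.Lex.inr_lt_inr_iff.1 hy) with h | ⟨h, h'⟩
        · rw [hlt j h]
        · obtain rfl : j = i := Fin.castLE_injective δ.size_le h
          refine ⟨?_, ?_⟩
          · rintro rfl
            have := hlt _ (δ.col.lt_iff_lt.1 h')
            exact absurd (π.injective this) hi
          · rintro rfl
            exact absurd h' (lt_irrefl _)
    · change δ.factorExponent _ _ _ < δ.factorExponent _ _ _
      rw [factorExponent_rightVar, factorExponent_rightVar]
      rw [Finset.sum_eq_zero]
      · exact Finset.sum_pos' (fun _ _ => Nat.zero_le _) ⟨i, Finset.mem_univ _, by simp⟩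
      · rintro j -
        rw [if_neg]
        rintro ⟨h1, h2⟩
        rw [hcκ] at h1
        obtain rfl : j = i := Fin.castLE_injective δ.size_le h1
        exact hi (δ.col.injective h2)
  · have hex : ∃ i, c i ≠ Fin.castLE δ.size_le i := by
      by_contra hcon
      push Not at hcon
      exact hcκ (funext hcon)
    obtain ⟨i, hi, hmin⟩ := WellFounded.has_min (wellFounded_lt (α := Fin δ.size)) _ hex
    have hlt : ∀ l, l < i → c l = Fin.castLE δ.size_le l := fun l hl => by
      by_contra h
      exact hmin l h hl
    refine ⟨leftVar (Fin.castLE δ.size_le i) (δ.row i), fun y hy => ?_, ?_⟩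
    · change δ.factorExponent _ _ y = δ.factorExponent _ _ y
      obtain ⟨⟨k, a⟩ | ⟨k, b⟩, rfl⟩ := toLex.surjective y
      · refine (factorExponent_leftVar ..).trans (Eq.trans ?_ (factorExponent_leftVar ..).symm)
        refine Finset.sum_congr rfl fun j _ => ?_
        congr 1
        rw [eq_iff_iff, and_congr_left_iff]
        rintro rfl
        rcases Prod.Lex.toLex_lt_toLex.1 (Sum.Lex.inl_lt_inl_iff.1 hy) with h | ⟨h, h'⟩
        · obtain ⟨l, hl, rfl⟩ : ∃ l, l < i ∧ k = Fin.castLE δ.size_le l :=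
            ⟨⟨k, (Fin.lt_def.1 h).trans i.2⟩, h, rfl⟩
          refine ⟨fun h2 => ?_, fun h2 => ?_⟩
          · rw [← hlt l hl] at h2
            rw [hc h2]
          · obtain rfl := Fin.castLE_injective δ.size_le h2
            exact hlt _ hl
        · rw [hlt j (δ.row.lt_iff_lt.1 h')]
      · exact absurd hy Sum.Lex.not_inr_lt_inl
    · change δ.factorExponent _ _ _ < δ.factorExponent _ _ _
      rw [factorExponent_leftVar, factorExponent_leftVar]
      rw [Finset.sum_eq_zero]
      · exact Finset.sum_pos' (fun _ _ => Nat.zero_le _) ⟨i, Finset.mem_univ _, by simp⟩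
      · rintro j -
        rw [if_neg]
        rintro ⟨h1, h2⟩
        obtain rfl : j = i := δ.row.injective h2
        exact hi h1

/-- Cauchy–Binet with the terms left uncollected: expansion by multilinearity in the rows, where a
non-injective `c` repeats a row and contributes `0`. -/
theorem factorHom_eval (K : Type*) [Field K] (δ : Minor m n) :
    factorHom K m n (δ.eval K) = ∑ c : Fin δ.size → Fin m, ∑ π : Equiv.Perm (Fin δ.size),
      if Function.Injective c then
        Equiv.Perm.sign π • monomial (δ.factorExponent c (δ.col ∘ π)) (1 : K) else 0 := by
  classical
  rw [eval, AlgHom.map_det]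
  have h1 : (factorHom K m n).mapMatrix
      (Matrix.of fun i j : Fin δ.size => X (δ.row i, δ.col j)) =
      fun i => ∑ k, fun j => (X (leftVar k (δ.row i)) * X (rightVar k (δ.col j)) :
        MvPolynomial (FactorVar m n) K) := by
    ext1 i j
    simp [factorHom, Finset.sum_apply]
  rw [h1]
  refine ((Matrix.detRowAlternating (R := MvPolynomial (FactorVar m n) K)
    (n := Fin δ.size)).toMultilinearMap.map_sum _).trans (Finset.sum_congr rfl fun c _ => ?_)
  change Matrix.det (Matrix.of fun i j => X (leftVar (c i) (δ.row i)) *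
    Matrix.of (fun i j => X (rightVar (c i) (δ.col j))) i j) = _
  split_ifs with hc
  · rw [← Matrix.det_transpose, Matrix.det_apply]
    refine Finset.sum_congr rfl fun π _ => ?_
    congr 1
    simp only [Matrix.transpose_apply, Matrix.of_apply, factorExponent, monomial_sum_one]
    refine Finset.prod_congr rfl fun i _ => ?_
    rw [X, X, monomial_mul, one_mul]
    rfl
  · rw [Matrix.det_mul_column, Finset.sum_const_zero]
    simp only [Function.Injective, not_forall] at hc
    obtain ⟨i, j, hij, hne⟩ := hc
    rw [Matrix.det_zero_of_row_eq hne (by ext; simp [hij]), mul_zero]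

theorem coeff_factorHom_eval (K : Type*) [Field K] (δ : Minor m n) :
    coeff δ.leadingExponent (factorHom K m n (δ.eval K)) = 1 := by
  classical
  rw [factorHom_eval, coeff_sum, Finset.sum_eq_single (Fin.castLE δ.size_le), coeff_sum,
    Finset.sum_eq_single 1]
  · rw [if_pos (Fin.castLE_injective _), Equiv.Perm.sign_one, one_smul]
    exact (coeff_monomial ..).trans (if_pos rfl)
  · intro π _ hπ
    rw [if_pos (Fin.castLE_injective _), Units.smul_def, coeff_smul, coeff_monomial, if_neg,
      smul_zero]
    intro h
    exact (δ.factorExponent_lt (Fin.castLE_injective _) π fun h => hπ h.2).ne (congrArg toLex h)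
  · simp
  · intro c _ hc
    rw [coeff_sum]
    refine Finset.sum_eq_zero fun π _ => ?_
    split_ifs with hci
    · rw [Units.smul_def, coeff_smul, coeff_monomial, if_neg, smul_zero]
      intro h
      exact (δ.factorExponent_lt hci π fun h => hc h.1).ne (congrArg toLex h)
    · rfl
  · simp

theorem le_leadingExponent_of_mem_support (K : Type*) [Field K] (δ : Minor m n)
    {e : FactorVar m n →₀ ℕ} (he : e ∈ (factorHom K m n (δ.eval K)).support) :
    toLex e ≤ toLex δ.leadingExponent := by
  classical
  rw [mem_support_iff, factorHom_eval, coeff_sum] at he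
  obtain ⟨c, -, hc⟩ := Finset.exists_ne_zero_of_sum_ne_zero he
  rw [coeff_sum] at hc
  obtain ⟨π, -, hπ⟩ := Finset.exists_ne_zero_of_sum_ne_zero hc
  split_ifs at hπ with hci
  · rw [Units.smul_def, coeff_smul, coeff_monomial] at hπ
    split_ifs at hπ with h
    · rw [← h]
      by_cases h1 : c = Fin.castLE δ.size_le ∧ π = 1
      · obtain ⟨rfl, rfl⟩ := h1
        exact le_rfl
      · exact (δ.factorExponent_lt hci π h1).le
    · exact absurd (smul_zero _) hπ
  · exact absurd rfl hπ

theorem degree_factorHom_eval (K : Type*) [Field K] (δ : Minor m n) :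
    MonomialOrder.lex.degree (factorHom K m n (δ.eval K)) = δ.leadingExponent := by
  refine MonomialOrder.lex.toSyn.injective (le_antisymm ?_ ?_)
  · exact MonomialOrder.degree_le_iff.2 fun c hc => δ.le_leadingExponent_of_mem_support K hc
  · refine MonomialOrder.le_degree ?_
    rw [mem_support_iff, coeff_factorHom_eval]
    exact one_ne_zero

theorem factorHom_eval_ne_zero (K : Type*) [Field K] (δ : Minor m n) :
    factorHom K m n (δ.eval K) ≠ 0 := fun h => by
  have := δ.coeff_factorHom_eval K
  rw [h, coeff_zero] at this
  exact zero_ne_one this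

theorem leadingExponent_leftVar_ne_zero (δ : Minor m n) (k a : Fin m) :
    δ.leadingExponent (leftVar k a) ≠ 0 ↔ ∃ i, Fin.castLE δ.size_le i = k ∧ δ.row i = a := by
  simp [leadingExponent, factorExponent_leftVar]

theorem leadingExponent_rightVar_ne_zero (δ : Minor m n) (k : Fin m) (b : Fin n) :
    δ.leadingExponent (rightVar k b) ≠ 0 ↔ ∃ i, Fin.castLE δ.size_le i = k ∧ δ.col i = b := by
  simp [leadingExponent, factorExponent_rightVar]

end Minor

namespace Bitableau

/-- The exponent of the leading monomial of a bitableau after the substitution. -/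
def leadingExponent (Δ : Bitableau m n) : FactorVar m n →₀ ℕ :=
  (Δ.map fun δ => δ.1.leadingExponent).sum

theorem factorHom_eval_ne_zero (K : Type*) [Field K] (Δ : Bitableau m n) :
    factorHom K m n (Δ.eval K) ≠ 0 := by
  rw [eval, map_multiset_prod, Multiset.map_map]
  refine Multiset.prod_ne_zero fun h => ?_
  obtain ⟨δ, -, hδ⟩ := Multiset.mem_map.1 h
  exact δ.1.factorHom_eval_ne_zero K hδ

theorem degree_factorHom_eval (K : Type*) [Field K] (Δ : Bitableau m n) :
    MonomialOrder.lex.degree (factorHom K m n (Δ.eval K)) = Δ.leadingExponent := by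
  induction Δ using Multiset.induction_on with
  | empty => simp [eval, leadingExponent]
  | cons δ Δ ih =>
    have h : eval K (δ ::ₘ Δ) = δ.1.eval K * eval K Δ := by simp [eval]
    rw [h, map_mul, MonomialOrder.degree_mul (δ.1.factorHom_eval_ne_zero K)
      (factorHom_eval_ne_zero K Δ), ih, Minor.degree_factorHom_eval]
    simp [leadingExponent]

theorem leadingExponent_ne_zero_iff (Δ : Bitableau m n) (x : FactorVar m n) :
    Δ.leadingExponent x ≠ 0 ↔ ∃ δ ∈ Δ, δ.1.leadingExponent x ≠ 0 := by
  induction Δ using Multiset.induction_on with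
  | empty => simp [leadingExponent]
  | cons δ Δ ih =>
    have h : leadingExponent (δ ::ₘ Δ) = δ.1.leadingExponent + leadingExponent Δ := by
      simp [leadingExponent]
    rw [h, Finsupp.add_apply, Ne, Nat.add_eq_zero_iff, not_and_or, ← Ne, ← Ne, ih]
    simp

/-- Each index of `δ`, with its position, occurs in the exponent of `Δ`, hence in that of some `ζ ∈
Δ'`; and `δ' ≤ ζ` bounds the index of `δ'` at the same position. -/
theorem le_of_leadingExponent_eq {Δ Δ' : Bitableau m n} (h : Δ.leadingExponent = Δ'.leadingExponent)
    {δ δ' : NonemptyMinor m n} (hδ : δ ∈ Δ) (hδ' : ∀ ζ ∈ Δ', δ' ≤ ζ) : δ' ≤ δ := by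
  have hrow : ∀ i : Fin δ.1.size, ∃ h : (i : ℕ) < δ'.1.size, δ'.1.row ⟨i, h⟩ ≤ δ.1.row i := by
    intro i
    have h1 : Δ.leadingExponent (leftVar (Fin.castLE δ.1.size_le i) (δ.1.row i)) ≠ 0 :=
      (leadingExponent_ne_zero_iff _ _).2 ⟨δ, hδ,
        (Minor.leadingExponent_leftVar_ne_zero ..).2 ⟨i, rfl, rfl⟩⟩
    rw [h, leadingExponent_ne_zero_iff] at h1
    obtain ⟨ζ, hζ, h2⟩ := h1
    obtain ⟨j, hj, hj'⟩ := (Minor.leadingExponent_leftVar_ne_zero ..).1 h2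
    obtain ⟨hs, hle⟩ := hδ' ζ hζ
    have hji : (j : ℕ) = i := congrArg Fin.val hj
    refine ⟨hji ▸ j.2.trans_le hs, hj' ▸ ?_⟩
    convert (hle j).1 using 3
    exact hji.symm
  have hcol : ∀ i : Fin δ.1.size, ∃ h : (i : ℕ) < δ'.1.size, δ'.1.col ⟨i, h⟩ ≤ δ.1.col i := by
    intro i
    have h1 : Δ.leadingExponent (rightVar (Fin.castLE δ.1.size_le i) (δ.1.col i)) ≠ 0 :=
      (leadingExponent_ne_zero_iff _ _).2 ⟨δ, hδ,
        (Minor.leadingExponent_rightVar_ne_zero ..).2 ⟨i, rfl, rfl⟩⟩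
    rw [h, leadingExponent_ne_zero_iff] at h1
    obtain ⟨ζ, hζ, h2⟩ := h1
    obtain ⟨j, hj, hj'⟩ := (Minor.leadingExponent_rightVar_ne_zero ..).1 h2
    obtain ⟨hs, hle⟩ := hδ' ζ hζ
    have hji : (j : ℕ) = i := congrArg Fin.val hj
    refine ⟨hji ▸ j.2.trans_le hs, hj' ▸ ?_⟩
    convert (hle j).2 using 3
    exact hji.symm
  refine ⟨?_, fun i => ⟨(hrow i).2, (hcol i).2⟩⟩
  have h1 := (hrow ⟨δ.1.size - 1, Nat.sub_lt δ.2 one_pos⟩).1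
  have := δ.2
  simp only at h1
  omega

theorem eq_nil_of_leadingExponent_eq_zero {l : List (NonemptyMinor m n)}
    (h : leadingExponent (l : Bitableau m n) = 0) : l = [] := by
  rcases l with _ | ⟨δ, l⟩
  · rfl
  · have h1 : leadingExponent ((δ :: l : List _) : Bitableau m n) (leftVar
        (Fin.castLE δ.1.size_le ⟨0, δ.2⟩) (δ.1.row ⟨0, δ.2⟩)) ≠ 0 :=
      (leadingExponent_ne_zero_iff _ _).2 ⟨δ, by simp,
        (Minor.leadingExponent_leftVar_ne_zero ..).2 ⟨_, rfl, rfl⟩⟩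
    rw [h] at h1
    exact absurd rfl h1

/-- The exponent determines the least factor of a chain, by the previous bound used in both
directions; it is then cancelled. -/
theorem list_eq_of_leadingExponent_eq : ∀ {l l' : List (NonemptyMinor m n)},
    l.Pairwise (· ≤ ·) → l'.Pairwise (· ≤ ·) →
    leadingExponent (l : Bitableau m n) = leadingExponent (l' : Bitableau m n) → l = l'
  | [], l', _, _, h => (eq_nil_of_leadingExponent_eq_zero (h.symm.trans (by
      simp [leadingExponent]))).symm
  | δ :: l, [], _, _, h => eq_nil_of_leadingExponent_eq_zero (h.trans (by simp [leadingExponent]))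
  | δ :: l, δ' :: l', hl, hl', h => by
    have hmin : ∀ {δ : NonemptyMinor m n} {l : List (NonemptyMinor m n)},
        (δ :: l).Pairwise (· ≤ ·) → ∀ ζ ∈ ((δ :: l : List _) : Bitableau m n), δ ≤ ζ := by
      intro δ l hl ζ hζ
      rcases List.mem_cons.1 (Multiset.mem_coe.1 hζ) with rfl | hζ
      · exact le_rfl
      · exact (List.pairwise_cons.1 hl).1 ζ hζ
    obtain rfl : δ = δ' := le_antisymm
      (le_of_leadingExponent_eq h.symm (by simp) (hmin hl))
      (le_of_leadingExponent_eq h (by simp) (hmin hl'))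
    rw [list_eq_of_leadingExponent_eq (List.pairwise_cons.1 hl).2 (List.pairwise_cons.1 hl').2]
    simpa [leadingExponent] using h

theorem IsStandard.eq_of_leadingExponent_eq {Δ Δ' : Bitableau m n} (hΔ : Δ.IsStandard)
    (hΔ' : Δ'.IsStandard) (h : Δ.leadingExponent = Δ'.leadingExponent) : Δ = Δ' := by
  obtain ⟨l, rfl, hl⟩ := hΔ
  obtain ⟨l', rfl, hl'⟩ := hΔ'
  rw [list_eq_of_leadingExponent_eq (List.isChain_iff_pairwise.1 hl)
    (List.isChain_iff_pairwise.1 hl') h]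

/-- The standard bitableaux are linearly independent. -/
theorem linearIndependent_eval (K : Type*) [Field K] (m n : ℕ) :
    LinearIndependent K fun Δ : {Δ : Bitableau m n // Δ.IsStandard} => eval K Δ.1 := by
  refine LinearIndependent.of_comp (factorHom K m n).toLinearMap
    (linearIndependent_of_degree_injective MonomialOrder.lex _
      (fun Δ => factorHom_eval_ne_zero K Δ.1) fun Δ Δ' h => Subtype.ext ?_)
  refine Δ.2.eq_of_leadingExponent_eq Δ'.2 ?_
  rw [← degree_factorHom_eval K, ← degree_factorHom_eval K]
  exact h

end Bitableau

end LinearIndependence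

/-! ### The straightening relations. -/

section Straightening

variable {K : Type*} [Field K] {m n : ℕ}

namespace Bitableau

theorem isStandard_pair_iff (γ δ : NonemptyMinor m n) :
    IsStandard {γ, δ} ↔ γ ≤ δ ∨ δ ≤ γ := by
  constructor
  · rintro ⟨l, hl, hc⟩
    by_cases hne : γ = δ
    · exact Or.inl hne.le
    · have hmem : ∀ ζ, ζ ∈ l ↔ ζ = γ ∨ ζ = δ := fun ζ => by
        rw [← Multiset.mem_coe, hl]
        simp
      have hp : l.Pairwise fun a b => a ≤ b ∨ b ≤ a :=
        (List.isChain_iff_pairwise.1 hc).imp Or.inl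
      have : Std.Symm fun a b : NonemptyMinor m n => a ≤ b ∨ b ≤ a := ⟨fun _ _ h => h.symm⟩
      exact hp.forall ((hmem γ).2 (Or.inl rfl)) ((hmem δ).2 (Or.inr rfl)) hne
  · rintro (h | h)
    · exact ⟨[γ, δ], rfl, by simpa using h⟩
    · exact ⟨[δ, γ], Multiset.pair_comm δ γ, by simpa using h⟩

/-- A minimal factor is least when all factors are comparable, so it can be put in front. -/
theorem isStandard_of_forall_pair (Δ : Bitableau m n)
    (h : ∀ γ ∈ Δ, ∀ δ ∈ Δ, γ ≤ δ ∨ δ ≤ γ) : Δ.IsStandard := by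
  classical
  induction hc : Δ.card generalizing Δ with
  | zero => exact ⟨[], (Multiset.card_eq_zero.1 hc).symm, List.isChain_nil⟩
  | succ k ih =>
    obtain ⟨a, ha⟩ := (Multiset.card_pos_iff_exists_mem (s := Δ)).1 (by omega)
    obtain ⟨δ, hδ⟩ := Δ.toFinset.exists_minimal ⟨a, Multiset.mem_toFinset.2 ha⟩
    have hδm : δ ∈ Δ := Multiset.mem_toFinset.1 hδ.1
    obtain ⟨l, hl, hlc⟩ := ih (Δ.erase δ)
      (fun γ hγ ζ hζ => h γ (Multiset.mem_of_mem_erase hγ) ζ (Multiset.mem_of_mem_erase hζ))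
      (by rw [Multiset.card_erase_of_mem hδm, hc, Nat.pred_succ])
    refine ⟨δ :: l, ?_, ?_⟩
    · rw [← Multiset.cons_coe, hl, Multiset.cons_erase hδm]
    · rw [List.isChain_iff_pairwise, List.pairwise_cons]
      refine ⟨fun ζ hζ => ?_, List.isChain_iff_pairwise.1 hlc⟩
      have hζ' : ζ ∈ Δ := Multiset.mem_of_mem_erase (hl ▸ Multiset.mem_coe.2 hζ)
      exact (h δ hδm ζ hζ').elim id fun hle => hδ.2 (Multiset.mem_toFinset.2 hζ') hle

theorem exists_pair_of_not_isStandard {Δ : Bitableau m n} (h : ¬ Δ.IsStandard) :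
    ∃ (γ δ : NonemptyMinor m n) (Δ' : Bitableau m n),
      Δ = {γ, δ} + Δ' ∧ ¬ IsStandard {γ, δ} := by
  have h1 := mt (isStandard_of_forall_pair Δ) h
  push Not at h1
  obtain ⟨γ, hγ, δ, hδ, h1⟩ := h1
  obtain ⟨Δ₁, rfl⟩ := Multiset.exists_cons_of_mem hγ
  rcases Multiset.mem_cons.1 hδ with rfl | hδ
  · exact absurd le_rfl h1.1
  · obtain ⟨Δ₂, rfl⟩ := Multiset.exists_cons_of_mem hδ
    refine ⟨γ, δ, Δ₂, by simp, fun hs => ?_⟩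
    exact ((isStandard_pair_iff γ δ).1 hs).elim h1.1 h1.2

theorem eval_zero : eval K (0 : Bitableau m n) = 1 := by simp [eval]

theorem eval_add (Δ Δ' : Bitableau m n) : eval K (Δ + Δ') = eval K Δ * eval K Δ' := by
  simp [eval]

theorem eval_singleton (δ : NonemptyMinor m n) : eval K {δ} = δ.1.eval K := by simp [eval]

theorem eval_ofMinor (η : Minor m n) : eval K (ofMinor η) = η.eval K := by
  unfold ofMinor
  split_ifs with h
  · exact eval_singleton _
  · have : IsEmpty (Fin η.size) := ⟨fun i => h (i.pos)⟩
    rw [eval_zero, Minor.eval, Matrix.det_isEmpty]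

theorem ofMinor_of_pos {η : Minor m n} (h : 0 < η.size) : ofMinor η = {⟨η, h⟩} := dif_pos h

theorem ofMinor_of_not_pos {η : Minor m n} (h : ¬ 0 < η.size) : ofMinor η = 0 := dif_neg h

theorem isStandard_singleton_add_ofMinor {ε : NonemptyMinor m n} {η : Minor m n} (h : ε.1 ≤ η) :
    IsStandard ({ε} + ofMinor η) := by
  by_cases hη : 0 < η.size
  · rw [ofMinor_of_pos hη]
    exact (isStandard_pair_iff ε ⟨η, hη⟩).2 (Or.inl h)
  · rw [ofMinor_of_not_pos hη, add_zero]
    exact ⟨[ε], rfl, List.isChain_singleton _⟩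

end Bitableau

open Bitableau

theorem Minor.eq_of_size_eq_zero {η η' : Minor m n} (h : η.size = 0) (h' : η'.size = 0) :
    η = η' := by
  have h1 : η.cols.card = 0 := η.card_eq.trans h
  have h2 : η'.cols.card = 0 := η'.card_eq.trans h'
  ext1
  · rw [Finset.card_eq_zero.1 h, Finset.card_eq_zero.1 h']
  · rw [Finset.card_eq_zero.1 h1, Finset.card_eq_zero.1 h2]

/-- If the two factors are matched crosswise, antisymmetry makes them all equal. -/
theorem eq_and_eq_of_singleton_add_ofMinor_eq {ε ε' : NonemptyMinor m n} {η η' : Minor m n}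
    (h : ε.1 ≤ η) (h' : ε'.1 ≤ η')
    (heq : ({ε} + ofMinor η : Bitableau m n) = {ε'} + ofMinor η') : ε = ε' ∧ η = η' := by
  by_cases hη : 0 < η.size <;> by_cases hη' : 0 < η'.size
  · rw [ofMinor_of_pos hη, ofMinor_of_pos hη'] at heq
    have h1 : ε = ε' ∧ (⟨η, hη⟩ : NonemptyMinor m n) = ⟨η', hη'⟩ ∨
        ε = ⟨η', hη'⟩ ∧ (⟨η, hη⟩ : NonemptyMinor m n) = ε' := by
      rw [Multiset.singleton_add, Multiset.singleton_add, Multiset.cons_eq_cons] at heq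
      rcases heq with ⟨h1, h2⟩ | ⟨-, cs, h1, h2⟩
      · exact Or.inl ⟨h1, Multiset.singleton_inj.1 h2⟩
      · rw [Multiset.singleton_eq_cons_iff] at h1 h2
        exact Or.inr ⟨h2.1.symm, h1.1⟩
    rcases h1 with ⟨h1, h2⟩ | ⟨h1, h2⟩
    · exact ⟨h1, congrArg Subtype.val h2⟩
    · subst h1
      subst h2
      have h3 : η' = η := le_antisymm h h'
      subst h3
      exact ⟨rfl, rfl⟩
  · rw [ofMinor_of_pos hη, ofMinor_of_not_pos hη'] at heq
    simpa using congrArg Multiset.card heq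
  · rw [ofMinor_of_not_pos hη, ofMinor_of_pos hη'] at heq
    simpa using congrArg Multiset.card heq
  · rw [ofMinor_of_not_pos hη, ofMinor_of_not_pos hη', add_zero, add_zero,
      Multiset.singleton_inj] at heq
    exact ⟨heq, Minor.eq_of_size_eq_zero (by omega) (by omega)⟩

theorem BitableauComb.eval_eq_linearCombination (f : BitableauComb K m n) :
    BitableauComb.eval f = Finsupp.linearCombination K (Bitableau.eval K) f := rfl

theorem BitableauComb.eq_of_eval_eq {f g : BitableauComb K m n}
    (hf : ∀ Δ ∈ f.support, Δ.IsStandard) (hg : ∀ Δ ∈ g.support, Δ.IsStandard)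
    (h : BitableauComb.eval f = BitableauComb.eval g) : f = g := by
  have hli : LinearIndepOn K (Bitableau.eval K) {Δ : Bitableau m n | Δ.IsStandard} :=
    linearIndependent_eval K m n
  rw [linearIndepOn_iff] at hli
  refine sub_eq_zero.1 (hli _ (Submodule.sub_mem _ ?_ ?_) ?_)
  · exact (Finsupp.mem_supported _ _).2 hf
  · exact (Finsupp.mem_supported _ _).2 hg
  · rw [map_sub, sub_eq_zero]
    exact h

/-- A one-sided form of the straightening relations. -/
theorem exists_eval_eq_mul (γ δ : NonemptyMinor m n) :
    ∃ r : BitableauComb K m n, BitableauComb.eval r = γ.1.eval K * δ.1.eval K ∧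
      ∀ Δ ∈ r.support, ∃ (ε : NonemptyMinor m n) (η : Minor m n),
        Δ = {ε} + ofMinor η ∧ ε.1 ≤ η ∧ ε ≤ γ ∧ δ.1 ≤ η := by
  set S : Set (Bitableau m n) := {Δ | ∃ (ε : NonemptyMinor m n) (η : Minor m n),
    Δ = {ε} + ofMinor η ∧ ε.1 ≤ η ∧ ε ≤ γ ∧ δ.1 ≤ η} with hS
  have hmem := minor_mul_mem (K := K) γ.1 δ.1 ((Finsupp.supported K K S).map
    (Finsupp.linearCombination K (Bitableau.eval K))).toAddSubgroup ?_
  · obtain ⟨r, hr, hr'⟩ := hmem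
    exact ⟨r, hr', fun Δ hΔ => (Finsupp.mem_supported _ _).1 hr hΔ⟩
  · intro ε η hεη hε hη
    have hpos : 0 < ε.size := γ.2.trans_le hε.1
    refine ⟨Finsupp.single ({⟨ε, hpos⟩} + ofMinor η) 1, ?_, ?_⟩
    · exact Finsupp.single_mem_supported _ _ ⟨⟨ε, hpos⟩, η, rfl, hεη, hε, hη⟩
    · rw [Finsupp.linearCombination_single, one_smul, Bitableau.eval_add, eval_singleton,
        eval_ofMinor]

theorem exists_isStraighteningRelation (γ δ : NonemptyMinor m n)
    (h : ¬ Bitableau.IsStandard {γ, δ}) :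
    ∃ r : BitableauComb K m n, IsStraighteningRelation γ δ r := by
  rw [isStandard_pair_iff, not_or] at h
  obtain ⟨r, hr, hrS⟩ := exists_eval_eq_mul (K := K) γ δ
  obtain ⟨r', hr', hrS'⟩ := exists_eval_eq_mul (K := K) δ γ
  have hst : ∀ Δ ∈ r.support, Δ.IsStandard := fun Δ hΔ => by
    obtain ⟨ε, η, rfl, hle, -⟩ := hrS Δ hΔ
    exact isStandard_singleton_add_ofMinor hle
  have hst' : ∀ Δ ∈ r'.support, Δ.IsStandard := fun Δ hΔ => by
    obtain ⟨ε, η, rfl, hle, -⟩ := hrS' Δ hΔ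
    exact isStandard_singleton_add_ofMinor hle
  -- Both one-sided relations represent the same polynomial by standard bitableaux, so they coincide
  -- and every term satisfies both sets of inequalities.
  obtain rfl : r = r' := BitableauComb.eq_of_eval_eq hst hst' (by rw [hr, hr', mul_comm])
  refine ⟨r, hr.symm, fun Δ hΔ => ⟨hst Δ hΔ, ?_⟩⟩
  obtain ⟨ε, η, hΔ1, hle, hεγ, hδη⟩ := hrS Δ hΔ
  obtain ⟨ε', η', hΔ2, hle', hεδ, hγη⟩ := hrS' Δ hΔ
  obtain ⟨rfl, rfl⟩ := eq_and_eq_of_singleton_add_ofMinor_eq hle hle' (hΔ1.symm.trans hΔ2)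
  -- Any equality here would make `γ` and `δ` comparable.
  refine ⟨ε, η, hΔ1, lt_of_le_of_ne hεγ ?_, lt_of_le_of_ne hεδ ?_, lt_of_le_of_ne hγη ?_,
    lt_of_le_of_ne hδη ?_⟩
  · rintro rfl
    exact h.1 hεδ
  · rintro rfl
    exact h.2 hεγ
  · rintro rfl
    exact h.2 hδη
  · rintro rfl
    exact h.1 hγη

/-! ### Termination of straightening. -/

section Termination

instance : Finite (Minor m n) :=
  Finite.of_injective (fun δ : Minor m n => (δ.rows, δ.cols)) fun _ _ h =>
    Minor.ext (congrArg Prod.fst h) (congrArg Prod.snd h)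

/-- The number of minors below a given one. -/
def Minor.height (δ : Minor m n) : ℕ := (Set.Iio δ).ncard

theorem Minor.height_lt {γ δ : Minor m n} (h : γ < δ) : γ.height < δ.height :=
  Set.ncard_lt_ncard ⟨Set.Iio_subset_Iio h.le, fun hs => lt_irrefl γ (hs h)⟩ (Set.toFinite _)

theorem Minor.height_le (δ : Minor m n) : δ.height ≤ Nat.card (Minor m n) :=
  Set.ncard_le_card _

/-- A weight of minors such that the total weight decreases when two minors are replaced by one
below both and one above both. -/
def Minor.weight (δ : Minor m n) : ℕ := 2 ^ Nat.card (Minor m n) - 2 ^ δ.height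

/-- `2 ^ η.height` is at least twice each of `2 ^ γ.height` and `2 ^ δ.height`, hence at least their
sum; `2 ^ ε.height > 0` makes the inequality strict. -/
theorem Minor.weight_add_weight_lt {γ δ ε η : Minor m n} (hγ : γ < η) (hδ : δ < η) :
    ε.weight + η.weight < γ.weight + δ.weight := by
  have hb : ∀ ζ : Minor m n, ζ.weight + 2 ^ ζ.height = 2 ^ Nat.card (Minor m n) := fun ζ =>
    Nat.sub_add_cancel (Nat.pow_le_pow_right two_pos ζ.height_le)
  have h1 : 2 ^ (γ.height + 1) ≤ 2 ^ η.height := Nat.pow_le_pow_right two_pos (height_lt hγ)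
  have h2 : 2 ^ (δ.height + 1) ≤ 2 ^ η.height := Nat.pow_le_pow_right two_pos (height_lt hδ)
  have h3 : 0 < 2 ^ ε.height := Nat.pow_pos two_pos
  have := hb γ
  have := hb δ
  have := hb ε
  have := hb η
  rw [pow_succ] at h1 h2
  omega

/-- The sum of the weights of the factors of a bitableau. -/
def Bitableau.weight (Δ : Bitableau m n) : ℕ := (Δ.map fun δ => δ.1.weight).sum

theorem Bitableau.weight_add (Δ Δ' : Bitableau m n) :
    (Δ + Δ').weight = Δ.weight + Δ'.weight := by
  simp [Bitableau.weight]

theorem IsStraighteningRelation.weight_lt {γ δ : NonemptyMinor m n} {r : BitableauComb K m n}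
    (hr : IsStraighteningRelation γ δ r) {Θ : Bitableau m n} (hΘ : Θ ∈ r.support) :
    Θ.weight < Bitableau.weight {γ, δ} := by
  obtain ⟨-, ε, η, rfl, -, -, hγ, hδ⟩ := hr.2 Θ hΘ
  have h1 : Bitableau.weight {γ, δ} = γ.1.weight + δ.1.weight := by simp [Bitableau.weight]
  have h2 : Bitableau.weight ({ε} : Bitableau m n) = ε.1.weight := by simp [Bitableau.weight]
  -- Dropping an empty `η` can only lower the weight.
  have h3 : (ofMinor η).weight ≤ η.weight := by
    unfold ofMinor
    split_ifs with h <;> simp [Bitableau.weight]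
  rw [weight_add, h1, h2]
  have := Minor.weight_add_weight_lt (ε := ε.1) hγ hδ
  omega

/-- The multiset of the weights of the bitableaux that occur in a linear combination. -/
def BitableauComb.weights (f : BitableauComb K m n) : Multiset ℕ :=
  f.support.val.map Bitableau.weight

/-- The treated bitableau leaves the support, and whatever enters the support is lighter than it;
further cancellation only removes elements. This is a descent in the Dershowitz–Manna order. -/
theorem StraighteningStep.weights_lt {f g : BitableauComb K m n} (h : StraighteningStep f g) :
    Multiset.IsDershowitzMannaLT (BitableauComb.weights g) (BitableauComb.weights f) := by
  classical
  obtain ⟨γ, δ, Δ', r, -, hr, hne, rfl⟩ := h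
  set Δ₀ : Bitableau m n := {γ, δ} + Δ' with hΔ₀
  set g := f.erase Δ₀ + f Δ₀ • r.mapDomain (fun Θ => Θ + Δ') with hg
  have hnew : ∀ Δ, (r.mapDomain fun Θ => Θ + Δ') Δ ≠ 0 → Δ.weight < Δ₀.weight := by
    intro Δ hΔ
    obtain ⟨Θ, hΘ, rfl⟩ := Finset.mem_image.1 (Finsupp.mapDomain_support
      (Finsupp.mem_support_iff.2 hΔ))
    rw [hΔ₀, weight_add, weight_add]
    exact Nat.add_lt_add_right (hr.weight_lt hΘ) _
  -- `Δ₀` cannot reappear on the right hand side, where all weights are smaller than its own.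
  have h0 : g Δ₀ = 0 := by
    rw [hg, Finsupp.add_apply, Finsupp.erase_same, Finsupp.smul_apply, zero_add,
      not_ne_iff.1 fun h => (hnew Δ₀ h).ne rfl, smul_zero]
  have hmem : Δ₀ ∈ f.support \ g.support := by
    simp [hne, h0]
  have hsplit : ∀ s t : Finset (Bitableau m n), s.val.map Bitableau.weight =
      (s ∩ t).val.map Bitableau.weight + (s \ t).val.map Bitableau.weight := by
    intro s t
    rw [← Multiset.map_add, ← Finset.disjUnion_val _ _ (Finset.disjoint_sdiff_inter s t).symm]
    congr 2
    ext a
    simp only [Finset.mem_disjUnion, Finset.mem_inter, Finset.mem_sdiff]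
    tauto
  refine ⟨(f.support ∩ g.support).val.map Bitableau.weight,
    (g.support \ f.support).val.map Bitableau.weight,
    (f.support \ g.support).val.map Bitableau.weight, ?_, ?_, hsplit _ _, ?_⟩
  · intro hz
    exact Multiset.notMem_zero _ (hz ▸ Multiset.mem_map_of_mem _ hmem)
  · rw [Finset.inter_comm]
    exact hsplit _ _
  · intro y hy
    obtain ⟨Δ, hΔ, rfl⟩ := Multiset.mem_map.1 hy
    refine ⟨_, Multiset.mem_map_of_mem _ hmem, hnew Δ fun hz => ?_⟩
    obtain ⟨h1, h2⟩ := Finset.mem_sdiff.1 hΔ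
    rw [Finsupp.mem_support_iff, hg, Finsupp.add_apply, Finsupp.smul_apply, hz, smul_zero,
      add_zero] at h1
    refine h2 (Finsupp.mem_support_iff.2 fun h3 => h1 ?_)
    by_cases hΔΔ : Δ = Δ₀
    · rw [hΔΔ, Finsupp.erase_same]
    · rw [Finsupp.erase_ne hΔΔ, h3]

theorem wellFounded_straighteningStep :
    WellFounded fun g f : BitableauComb K m n => StraighteningStep f g :=
  Subrelation.wf (fun h => StraighteningStep.weights_lt h)
    (InvImage.wf BitableauComb.weights Multiset.wellFounded_isDershowitzMannaLT)

end Termination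

/-! ### Terminal combinations and spanning. -/

theorem StraighteningStep.eval_eq {f g : BitableauComb K m n} (h : StraighteningStep f g) :
    BitableauComb.eval g = BitableauComb.eval f := by
  obtain ⟨γ, δ, Δ', r, -, hr, -, rfl⟩ := h
  have h1 : Finsupp.linearCombination K (Bitableau.eval K) (r.mapDomain fun Θ => Θ + Δ') =
      Bitableau.eval K ({γ, δ} + Δ') := by
    have h2 : Bitableau.eval K ({γ, δ} : Bitableau m n) = γ.1.eval K * δ.1.eval K := by
      simp [Bitableau.eval]
    rw [Finsupp.linearCombination_mapDomain, Bitableau.eval_add, h2, hr.1, BitableauComb.eval,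
      Finsupp.linearCombination_apply, Finsupp.sum_mul]
    refine Finsupp.sum_congr fun Θ _ => ?_
    rw [Function.comp, Bitableau.eval_add, smul_mul_assoc]
  rw [BitableauComb.eval_eq_linearCombination, BitableauComb.eval_eq_linearCombination, map_add,
    map_smul, h1]
  conv_rhs => rw [← Finsupp.erase_add_single ({γ, δ} + Δ') f]
  rw [(Finsupp.linearCombination K (Bitableau.eval K)).map_add, Finsupp.linearCombination_single]

theorem eval_eq_of_reflTransGen {f g : BitableauComb K m n}
    (h : Relation.ReflTransGen StraighteningStep f g) :
    BitableauComb.eval g = BitableauComb.eval f := by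
  induction h with
  | refl => rfl
  | tail _ h ih => rw [h.eval_eq, ih]

theorem isStandard_of_forall_not_straighteningStep {f : BitableauComb K m n}
    (hf : ∀ g, ¬ StraighteningStep f g) {Δ : Bitableau m n} (hΔ : Δ ∈ f.support) :
    Δ.IsStandard := by
  by_contra hns
  obtain ⟨γ, δ, Δ', rfl, hp⟩ := exists_pair_of_not_isStandard hns
  obtain ⟨r, hr⟩ := exists_isStraighteningRelation (K := K) γ δ hp
  exact hf _ ⟨γ, δ, Δ', r, hp, hr, Finsupp.mem_support_iff.1 hΔ, rfl⟩

theorem isStandardRepresentation_of_reflTransGen {Δ : Bitableau m n} {f : BitableauComb K m n}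
    (h : Relation.ReflTransGen StraighteningStep (Finsupp.single Δ 1) f)
    (hf : ∀ g, ¬ StraighteningStep f g) : IsStandardRepresentation (Bitableau.eval K Δ) f := by
  refine ⟨fun Δ hΔ => isStandard_of_forall_not_straighteningStep hf hΔ, ?_⟩
  rw [eval_eq_of_reflTransGen h, BitableauComb.eval_eq_linearCombination,
    Finsupp.linearCombination_single, one_smul]

theorem exists_reflTransGen_terminal (f : BitableauComb K m n) :
    ∃ g, Relation.ReflTransGen StraighteningStep f g ∧ ∀ h, ¬ StraighteningStep g h := by
  induction f using wellFounded_straighteningStep.induction with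
  | _ f ih =>
    by_cases hf : ∃ g, StraighteningStep f g
    · obtain ⟨g, hg⟩ := hf
      obtain ⟨h, hgh, hh⟩ := ih g hg
      exact ⟨h, Relation.ReflTransGen.head hg hgh, hh⟩
    · exact ⟨f, Relation.ReflTransGen.refl, not_exists.1 hf⟩

/-- The `1 × 1` minors. -/
def entryMinor (i : Fin m) (j : Fin n) : NonemptyMinor m n := ⟨⟨{i}, {j}, rfl⟩, Nat.one_pos⟩

theorem eval_entryMinor (i : Fin m) (j : Fin n) : (entryMinor i j).1.eval K = X (i, j) := by
  have hi : ∀ k, (entryMinor i j).1.row k = i := fun k =>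
    Finset.mem_singleton.1 ((entryMinor i j).1.row_mem k)
  have hj : ∀ k, (entryMinor i j).1.col k = j := fun k =>
    Finset.mem_singleton.1 ((entryMinor i j).1.col_mem k)
  rw [Minor.eval, Matrix.det_eq_elem_of_card_eq_one (by rw [Fintype.card_fin]; rfl)
    ⟨0, (entryMinor i j).2⟩, Matrix.of_apply, hi, hj]

theorem span_range_eval_eq_top :
    Submodule.span K (Set.range (Bitableau.eval (m := m) (n := n) K)) = ⊤ := by
  rw [eq_top_iff]
  rintro p -
  induction p using MvPolynomial.induction_on with
  | C a =>
    rw [← mul_one (C a), ← smul_eq_C_mul, ← Bitableau.eval_zero]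
    exact Submodule.smul_mem _ _ (Submodule.subset_span ⟨0, rfl⟩)
  | add p q hp hq => exact Submodule.add_mem _ hp hq
  | mul_X p ij hp =>
    refine Submodule.span_induction (p := fun p _ => p * X ij ∈ _) ?_ ?_ ?_ ?_ hp
    · rintro _ ⟨Δ, rfl⟩
      refine Submodule.subset_span ⟨Δ + {entryMinor ij.1 ij.2}, ?_⟩
      rw [Bitableau.eval_add, eval_singleton, eval_entryMinor]
    · rw [zero_mul]
      exact Submodule.zero_mem _
    · intro p q _ _ hp hq
      rw [add_mul]
      exact Submodule.add_mem _ hp hq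
    · intro a p _ hp
      rw [smul_mul_assoc]
      exact Submodule.smul_mem _ _ hp

/-- Bitableaux span, and straightening each of them to the end leaves only standard ones. -/
theorem span_range_standard_eq_top :
    ⊤ ≤ Submodule.span K (Set.range fun Δ : {Δ : Bitableau m n // Δ.IsStandard} =>
      Bitableau.eval K Δ.1) := by
  rw [← span_range_eval_eq_top, Submodule.span_le]
  rintro _ ⟨Δ, rfl⟩
  obtain ⟨f, hf, hterm⟩ := exists_reflTransGen_terminal (K := K) (Finsupp.single Δ 1)
  obtain ⟨hst, heq⟩ := isStandardRepresentation_of_reflTransGen hf hterm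
  rw [heq]
  exact Submodule.sum_mem _ fun Θ hΘ =>
    Submodule.smul_mem _ _ (Submodule.subset_span ⟨⟨Θ, hst Θ hΘ⟩, rfl⟩)

end Straightening
end StraighteningLaw
end
open StraighteningLaw in
theorem theorem1p1 (K : Type*) [Field K] (m n : ℕ) :
    -- (a) the standard bitableaux form a basis of the vector space `K[X]`
    (∃ b : Module.Basis {Δ : Bitableau m n // Δ.IsStandard} K (MvPolynomial (Fin m × Fin n) K),
      ∀ Δ, b Δ = Bitableau.eval K Δ.1) ∧
    -- (b) the straightening relations
    (∀ γ δ : NonemptyMinor m n, ¬ Bitableau.IsStandard {γ, δ} →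
      ∃ r : BitableauComb K m n, IsStraighteningRelation γ δ r) ∧
    -- (c) successive application of straightening relations to a bitableau reaches its standard
    -- representation; it does so whatever choices are made, after finitely many steps
    (∀ Δ : Bitableau m n,
      (∃ f : BitableauComb K m n,
        Relation.ReflTransGen StraighteningStep (Finsupp.single Δ 1) f ∧
        IsStandardRepresentation (Bitableau.eval K Δ) f) ∧
      (∀ f : BitableauComb K m n,
        Relation.ReflTransGen StraighteningStep (Finsupp.single Δ 1) f →
        (∀ g : BitableauComb K m n, ¬ StraighteningStep f g) →
        IsStandardRepresentation (Bitableau.eval K Δ) f) ∧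
      ¬ ∃ s : ℕ → BitableauComb K m n,
        s 0 = Finsupp.single Δ 1 ∧ ∀ i, StraighteningStep (s i) (s (i + 1))) := by
  refine ⟨⟨Module.Basis.mk (Bitableau.linearIndependent_eval K m n) span_range_standard_eq_top,
    fun Δ => Module.Basis.mk_apply _ _ Δ⟩, exists_isStraighteningRelation, fun Δ => ⟨?_, ?_, ?_⟩⟩
  · obtain ⟨f, hf, hterm⟩ := exists_reflTransGen_terminal (K := K) (Finsupp.single Δ 1)
    exact ⟨f, hf, isStandardRepresentation_of_reflTransGen hf hterm⟩
  · exact fun f hf hterm => isStandardRepresentation_of_reflTransGen hf hterm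
  · rintro ⟨s, -, hs⟩
    obtain ⟨_, ⟨i, rfl⟩, hmin⟩ := wellFounded_straighteningStep.has_min (Set.range s) ⟨_, 0, rfl⟩
    exact hmin _ ⟨i + 1, rfl⟩ (hs i)
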